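/- All rings are commutative with identity and all modules are unital. For a ring $R$ let $\mathrm{Nil}(R)$ be its nilradical. $R$ is a $\phi$-ring if $\mathrm{Nil}(R)$ is a prime ideal and $\mathrm{Nil}(R)\subsetneq (x)$ for every $x\in R\setminus \mathrm{Nil}(R)$. An ideal of $R$ is nonnil if it is not contained in $\mathrm{Nil}(R)$. A $\phi$-ring $R$ is nonnil-coherent if every finitely generated nonnil ideal of $R$ is finitely presented. An $R$-module $T$ is $\phi$-torsion if for every $x\in T$ there is a nonnil ideal $I$ of $R$ with $Ix=0$. An $R$-module $M$ is $\phi$-flat if $\mathrm{Tor}_1^R(T,M)=0$ for every $\phi$-torsion module $T$; it is nonnil-injective if $\mathrm{Ext}^1_R(T,M)=0$ for every $\phi$-torsion module $T$; and it is nonnil-FP-injective if $\mathrm{Ext}^1_R(T,M)=0$ for every finitely presented $\phi$-torsion module $T$. **Theorem.** Let $R$ be a $\phi$-ring. The following statements are equivalent: 1. $R$ is nonnil-coherent; 2. $\mathrm{Hom}_R(M,E)$ is $\phi$-flat for every nonnil-FP-injective $R$-module $M$ and every injective $R$-module $E$; 3. $\mathrm{Hom}_R(M,E)$ is $\phi$-flat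 for every nonnil-injective $R$-module $M$ and every injective $R$-module $E$; 4. $\mathrm{Hom}_R(\mathrm{Hom}_R(M,E_1),E_2)$ is $\phi$-flat for every $\phi$-flat $R$-module $M$ and all injective $R$-modules $E_1,E_2$; 5. for all injective cogenerators $E_1,E_2$ of the category of $R$-modules and every $\phi$-flat $R$-module $M$, the module $\mathrm{Hom}_R(\mathrm{Hom}_R(M,E_1),E_2)$ is $\phi$-flat. -/

import Mathlib

open CategoryTheory

universe u

namespace PhiRing

section Rings

variable (R : Type u) [CommRing R]

/-- `R` is a φ-ring: the nilradical is a divided prime ideal, i.e. it is prime and strictly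
contained in every principal ideal `(x)` with `x` not nilpotent. -/
def IsPhiRing : Prop :=
  (nilradical R).IsPrime ∧ ∀ x : R, x ∉ nilradical R → nilradical R < Ideal.span {x}

variable {R} in
/-- An ideal is nonnil if it is not contained in the nilradical. -/
def IsNonnil (I : Ideal R) : Prop :=
  ¬ I ≤ nilradical R

/-- Every finitely generated nonnil ideal is finitely presented. -/
def IsNonnilCoherent : Prop :=
  ∀ I : Ideal R, I.FG → IsNonnil I → Module.FinitePresentation R I

end Rings

section Modules

variable (R : Type u) [CommRing R] (M : Type u) [AddCommGroup M] [Module R M]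

/-- Every element of `M` is killed by some nonnil ideal. -/
def IsPhiTorsion : Prop :=
  ∀ x : M, ∃ I : Ideal R, IsNonnil I ∧ ∀ r ∈ I, r • x = 0

/-- `Tor₁(T, M) = 0` for every φ-torsion module `T`. -/
def IsPhiFlat : Prop :=
  ∀ (T : Type u) [AddCommGroup T] [Module R T], IsPhiTorsion R T →
    Limits.IsZero (((Tor (ModuleCat.{u} R) 1).obj (ModuleCat.of R T)).obj (ModuleCat.of R M))

/-- `Ext¹(T, M) = 0` for every φ-torsion module `T`. -/
def IsNonnilInjective : Prop :=
  ∀ (T : Type u) [AddCommGroup T] [Module R T], IsPhiTorsion R T →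
    Subsingleton (Abelian.Ext (ModuleCat.of R T) (ModuleCat.of R M) 1)

/-- `Ext¹(T, M) = 0` for every finitely presented φ-torsion module `T`. -/
def IsNonnilFPInjective : Prop :=
  ∀ (T : Type u) [AddCommGroup T] [Module R T], Module.FinitePresentation R T →
    IsPhiTorsion R T →
      Subsingleton (Abelian.Ext (ModuleCat.of R T) (ModuleCat.of R M) 1)

/-- `M` is injective and cogenerates the category of `R`-modules. -/
def IsInjectiveCogenerator : Prop :=
  Module.Injective R M ∧ IsCoseparator (ModuleCat.of R M)

end Modules

end PhiRing

namespace PhiRing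

/-! ### Ext¹ as the obstruction to extending maps -/

section Ext

variable {R : Type u} [CommRing R] {J P T M : Type u} [AddCommGroup J] [Module R J]
  [AddCommGroup P] [Module R P] [AddCommGroup T] [Module R T] [AddCommGroup M] [Module R M]
  {f : J →ₗ[R] P} {g : P →ₗ[R] T}

/-! The proof runs the cycle 1 → 2 → 3 → 4 → 5 → 1 on two facts. First, φ-flatness of `N` is
injectivity of `I ⊗ N → N` for finitely generated nonnil `I` (`isPhiFlat_iff_forall_fg_nonnil`):
character duality turns it into extending maps, where Baer's argument only meets nonnil ideals.
Second, for `I = (a₁, …, aₙ)` that injectivity says that each relation `∑ aᵢ yᵢ = 0` in `N` comes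
from finitely many relations over `R`.

If `I` is finitely presented, its finitely many relations suffice for `N = Hom(M, E)`, giving 1 → 2.
Tensor-hom adjunction gives 3 → 4. For 5 → 1, let `K` be the module of all relations among the `aᵢ`.
The bidual of the free module on the set `K` is `Hom(E^K, E)`, which carries one relation encoding
every element of `K`; trivialising it yields finitely many generators of `K` (`relations_fg`). -/

lemma exists_shortExact (hf : Function.Injective f) (hg : Function.Surjective g)
    (hfg : Function.Exact f g) :
    ∃ w : ModuleCat.ofHom f ≫ ModuleCat.ofHom g = 0,
      (ShortComplex.mk (ModuleCat.ofHom f) (ModuleCat.ofHom g) w).ShortExact :=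
  ⟨ModuleCat.hom_ext hfg.linearMap_comp_eq_zero,
    ModuleCat.shortComplex_shortExact _ hfg hf hg⟩

/-- If `Ext¹(P/J, M) = 0` then every map `J → M` extends to `P`. -/
lemma exists_extension_of_subsingleton_ext (hf : Function.Injective f)
    (hg : Function.Surjective g) (hfg : Function.Exact f g)
    (hT : Subsingleton (Abelian.Ext (ModuleCat.of R T) (ModuleCat.of R M) 1)) (h : J →ₗ[R] M) :
    ∃ h' : P →ₗ[R] M, h' ∘ₗ f = h := by
  obtain ⟨w, hS⟩ := exists_shortExact hf hg hfg
  obtain ⟨x, hx⟩ := Abelian.Ext.contravariant_sequence_exact₁ hS _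
    (Abelian.Ext.mk₀ (ModuleCat.ofHom h)) (add_zero 1) (hT.elim _ _)
  obtain ⟨k, rfl⟩ := Abelian.Ext.mk₀_bijective _ _ |>.2 x
  rw [Abelian.Ext.mk₀_comp_mk₀] at hx
  have := (Abelian.Ext.mk₀_bijective _ _).1 hx
  exact ⟨k.hom, congrArg ModuleCat.Hom.hom this⟩

/-- If `P` is projective and every map `J → M` extends to `P`, then `Ext¹(P/J, M) = 0`. -/
lemma subsingleton_ext_of_exists_extension [Module.Projective R P] (hf : Function.Injective f)
    (hg : Function.Surjective g) (hfg : Function.Exact f g)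
    (h : ∀ k : J →ₗ[R] M, ∃ k' : P →ₗ[R] M, k' ∘ₗ f = k) :
    Subsingleton (Abelian.Ext (ModuleCat.of R T) (ModuleCat.of R M) 1) := by
  obtain ⟨w, hS⟩ := exists_shortExact hf hg hfg
  have : Projective (ModuleCat.of R P) := (IsProjective.iff_projective P).1 inferInstance
  refine subsingleton_of_forall_eq 0 fun x => ?_
  obtain ⟨y, hy⟩ := Abelian.Ext.contravariant_sequence_exact₃ hS _ x
    (Abelian.Ext.eq_zero_of_projective (P := ModuleCat.of R P) _) (add_zero 1)
  obtain ⟨k, rfl⟩ := Abelian.Ext.mk₀_bijective _ _ |>.2 y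
  obtain ⟨k', hk'⟩ := h k.hom
  have hk : k = ModuleCat.ofHom f ≫ ModuleCat.ofHom k' := ModuleCat.hom_ext hk'.symm
  rw [← hy, hk, ← Abelian.Ext.mk₀_comp_mk₀]
  exact hS.extClass_comp_assoc _

end Ext

/-! ### Tor₁ as a kernel, resolving either variable -/

section Tor

variable {R : Type u} [CommRing R]

open TensorProduct

/-- `Tor₁(T, M)` computed by the start of a projective resolution of `M`. -/
lemma exists_resolution_tor (M : Type u) [AddCommGroup M] [Module R M] :
    ∃ (X : ℕ → ModuleCat.{u} R) (d₂ : X 2 →ₗ[R] X 1) (d₁ : X 1 →ₗ[R] X 0) (π : X 0 →ₗ[R] M),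
      Module.Projective R (X 0) ∧ Function.Exact d₂ d₁ ∧ Function.Exact d₁ π ∧
      Function.Surjective π ∧ ∀ (T : Type u) [AddCommGroup T] [Module R T],
        Limits.IsZero (((Tor (ModuleCat.{u} R) 1).obj (ModuleCat.of R T)).obj (ModuleCat.of R M)) ↔
          Function.Exact (d₂.lTensor T) (d₁.lTensor T) := by
  let P := projectiveResolution (ModuleCat.of R M)
  let e := HomologicalComplex.singleObjXSelf (ComplexShape.down ℕ) 0 (ModuleCat.of R M)
  refine ⟨P.complex.X, (P.complex.d 2 1).hom, (P.complex.d 1 0).hom,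
    (P.π.f 0 ≫ e.hom).hom, (IsProjective.iff_projective _).2 (P.projective 0),
    (ShortComplex.ShortExact.moduleCat_exact_iff_function_exact _).1 (P.exact_succ 0), ?_,
    (ModuleCat.epi_iff_surjective _).1 inferInstance, ?_⟩
  · have h := (ShortComplex.ShortExact.moduleCat_exact_iff_function_exact _).1 P.exact₀
    have he : Function.Injective e.hom.hom := (ModuleCat.mono_iff_injective _).1 inferInstance
    intro x
    refine Iff.trans ?_ (h x)
    exact map_eq_zero_iff e.hom.hom he
  · intro T _ _
    let F := (MonoidalCategory.tensoringLeft (ModuleCat.{u} R)).obj (ModuleCat.of R T)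
    refine (P.isoLeftDerivedObj F 1).isZero_iff.trans ?_
    refine (HomologicalComplex.exactAt_iff_isZero_homology _ _).symm.trans ?_
    refine (HomologicalComplex.exactAt_iff' _ 2 1 0 (by simp) (by simp)).trans ?_
    exact ShortComplex.ShortExact.moduleCat_exact_iff_function_exact _

lemma lTensor_rTensor_comm {A A' B B' : Type*} [AddCommGroup A] [Module R A] [AddCommGroup A']
    [Module R A'] [AddCommGroup B] [Module R B] [AddCommGroup B'] [Module R B'] (u : A →ₗ[R] A')
    (v : B →ₗ[R] B') (x : A ⊗[R] B) :
    v.lTensor A' (u.rTensor B x) = u.rTensor B' (v.lTensor A x) := by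
  rw [← LinearMap.comp_apply, ← LinearMap.comp_apply, LinearMap.lTensor_comp_rTensor,
    LinearMap.rTensor_comp_lTensor]

/-- Given `0 → K → F → M → 0` and `0 → J → P → T → 0` exact with `P` flat, injectivity of
`J ⊗ M → P ⊗ M` implies injectivity of `T ⊗ K → T ⊗ F`. -/
lemma lTensor_injective_of_rTensor_injective {J P T K F M : Type*}
    [AddCommGroup J] [Module R J] [AddCommGroup P] [Module R P] [AddCommGroup T] [Module R T]
    [AddCommGroup K] [Module R K] [AddCommGroup F] [Module R F] [AddCommGroup M] [Module R M]
    [Module.Flat R P] {f : J →ₗ[R] P} {g : P →ₗ[R] T} {i : K →ₗ[R] F} {p : F →ₗ[R] M}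
    (hg : Function.Surjective g) (hfg : Function.Exact f g)
    (hi : Function.Injective i) (hp : Function.Surjective p) (hip : Function.Exact i p)
    (h : Function.Injective (f.rTensor M)) : Function.Injective (i.lTensor T) := by
  rw [injective_iff_map_eq_zero]
  intro t ht
  obtain ⟨a, rfl⟩ := LinearMap.rTensor_surjective K hg t
  rw [lTensor_rTensor_comm] at ht
  obtain ⟨b, hb⟩ := (rTensor_exact F hfg hg _).1 ht
  have hb0 : p.lTensor J b = 0 := by
    apply h
    rw [← lTensor_rTensor_comm, hb, map_zero]
    exact (lTensor_exact P hip hp _).2 ⟨a, rfl⟩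
  obtain ⟨c, rfl⟩ := (lTensor_exact J hip hp _).1 hb0

  have := Module.Flat.lTensor_preserves_injective_linearMap (M := P) i hi
  rw [← lTensor_rTensor_comm] at hb
  rw [← this hb]
  exact (rTensor_exact K hfg hg _).2 ⟨c, rfl⟩

/-- Balancing of Tor: both kernels compute `Tor₁(T, M)`. The converse is the same chase with the two
sequences exchanged. -/
lemma rTensor_injective_iff_lTensor_injective {J P T K F M : Type*}
    [AddCommGroup J] [Module R J] [AddCommGroup P] [Module R P] [AddCommGroup T] [Module R T]
    [AddCommGroup K] [Module R K] [AddCommGroup F] [Module R F] [AddCommGroup M] [Module R M]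
    [Module.Flat R P] [Module.Flat R F] {f : J →ₗ[R] P} {g : P →ₗ[R] T} {i : K →ₗ[R] F}
    {p : F →ₗ[R] M} (hf : Function.Injective f) (hg : Function.Surjective g)
    (hfg : Function.Exact f g) (hi : Function.Injective i) (hp : Function.Surjective p)
    (hip : Function.Exact i p) :
    Function.Injective (f.rTensor M) ↔ Function.Injective (i.lTensor T) := by
  refine ⟨lTensor_injective_of_rTensor_injective hg hfg hi hp hip, fun h => ?_⟩
  rw [← LinearMap.lTensor_inj_iff_rTensor_inj]
  rw [LinearMap.lTensor_inj_iff_rTensor_inj] at h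
  exact lTensor_injective_of_rTensor_injective hp hip hf hg hfg h

/-- `Tor₁(T, M)` vanishes iff `J ⊗ M → P ⊗ M` is injective, where `T = P / J` with `P` flat. -/
lemma isZero_tor_iff_rTensor_injective {J P T M : Type u}
    [AddCommGroup J] [Module R J] [AddCommGroup P] [Module R P] [AddCommGroup T] [Module R T]
    [AddCommGroup M] [Module R M] [Module.Flat R P] {f : J →ₗ[R] P} {g : P →ₗ[R] T}
    (hf : Function.Injective f) (hg : Function.Surjective g) (hfg : Function.Exact f g) :
    Limits.IsZero (((Tor (ModuleCat.{u} R) 1).obj (ModuleCat.of R T)).obj (ModuleCat.of R M)) ↔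
      Function.Injective (f.rTensor M) := by
  obtain ⟨X, d₂, d₁, π, _, hd, hπ, hs, H⟩ := exists_resolution_tor (R := R) M
  rw [H T, rTensor_injective_iff_lTensor_injective hf hg hfg
    (LinearMap.range d₁).injective_subtype hs (by rw [LinearMap.exact_iff, Submodule.range_subtype, LinearMap.exact_iff.1 hπ])]
  have hd' : Function.Exact d₂ d₁.rangeRestrict := by
    rw [LinearMap.exact_iff] at hd ⊢
    rw [LinearMap.ker_rangeRestrict, hd]
  -- Right exactness identifies `T ⊗ im d₁` with the cokernel of `T ⊗ d₂`, so exactness at `T ⊗ X 1`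
  -- is injectivity of `T ⊗ im d₁ → T ⊗ X 0`.
  have key := lTensor_exact T hd' d₁.surjective_rangeRestrict
  have hsurj := LinearMap.lTensor_surjective T d₁.surjective_rangeRestrict
  have hcomp (x) : d₁.lTensor T x =
      (LinearMap.range d₁).subtype.lTensor T (d₁.rangeRestrict.lTensor T x) := by
    rw [← LinearMap.lTensor_comp_apply]; rfl
  rw [injective_iff_map_eq_zero]
  refine ⟨fun h y hy => ?_, fun h x => ?_⟩
  · obtain ⟨x, rfl⟩ := hsurj y
    rw [← hcomp, h x] at hy
    exact (key x).2 hy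
  · rw [hcomp, ← key x]
    exact ⟨h _, fun h => by rw [h, map_zero]⟩

end Tor

/-! ### Baer's criterion for φ-torsion quotients -/

section Baer

/-- **Baer's criterion** relative to nonnil ideals. -/
lemma exists_extension_of_forall_nonnil {R : Type u} [CommRing R] {N P Q : Type*}
    [AddCommGroup N] [Module R N] [AddCommGroup P] [Module R P] [AddCommGroup Q] [Module R Q]
    (hQ : ∀ I : Ideal R, IsNonnil I → ∀ g : I →ₗ[R] Q, ∃ g' : R →ₗ[R] Q, g' ∘ₗ I.subtype = g)
    (i : N →ₗ[R] P) (hi : Function.Injective i)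
    (hT : ∀ p : P, ∃ I : Ideal R, IsNonnil I ∧ ∀ r ∈ I, r • p ∈ LinearMap.range i)
    (f : N →ₗ[R] Q) : ∃ f' : P →ₗ[R] Q, f' ∘ₗ i = f := by
  have : Fact (Function.Injective i) := ⟨hi⟩
  let e := Module.Baer.extensionOfMax i f
  have htop : e.domain = ⊤ := by
    refine Submodule.eq_top_iff'.2 fun y => ?_
    obtain ⟨I, hI, hIy⟩ := hT y
    let I' := Module.Baer.ExtensionOfMaxAdjoin.ideal i f y
    -- `I'` is `{r | r • y ∈ e.domain}`; it contains `I`, hence is nonnil.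
    have hI' : IsNonnil I' := fun h => hI (le_trans (fun r hr => e.le (hIy r hr)) h)
    obtain ⟨φ, hφ⟩ := hQ I' hI' (Module.Baer.ExtensionOfMaxAdjoin.idealTo i f y)
    have hφ' (r : R) (hr : r • y ∈ e.domain) : φ r = e.toLinearPMap ⟨r • y, hr⟩ :=
      LinearMap.congr_fun hφ ⟨r, hr⟩
    -- The map `r • y ↦ φ r`, well defined because `φ` kills the annihilator of `y`.
    let k : Submodule.span R {y} →ₗ[R] Q :=
      (LinearMap.ker (LinearMap.toSpanSingleton R P y)).liftQ φ (fun r hr => by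
        have hr0 : r • y = 0 := hr
        rw [LinearMap.mem_ker, hφ' r (by rw [hr0]; exact zero_mem _)]
        convert! e.toLinearPMap.map_zero) ∘ₗ
      ((LinearMap.toSpanSingleton R P y).quotKerEquivRange ≪≫ₗ
        LinearEquiv.ofEq _ _ (LinearMap.range_toSpanSingleton y)).symm.toLinearMap
    have hk (r : R) (hr : r • y ∈ Submodule.span R {y}) : k ⟨r • y, hr⟩ = φ r := by
      have : ((LinearMap.toSpanSingleton R P y).quotKerEquivRange ≪≫ₗ
        LinearEquiv.ofEq _ _ (LinearMap.range_toSpanSingleton y)).symm ⟨r • y, hr⟩ =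
          Submodule.Quotient.mk r := by
        rw [LinearEquiv.symm_apply_eq]; rfl
      simp only [k, LinearMap.comp_apply, LinearEquiv.coe_coe, this]
      rfl
    let l : P →ₗ.[R] Q := ⟨Submodule.span R {y}, k⟩
    have hcompat (x : e.domain) (z : l.domain) (hxz : (x : P) = z) :
        e.toLinearPMap x = l z := by
      obtain ⟨x, hx⟩ := x
      obtain ⟨z, hz⟩ := z
      obtain ⟨r, rfl⟩ := Submodule.mem_span_singleton.1 hz
      obtain rfl : x = r • y := hxz
      rw [← hφ' r hx]
      exact (hk r hz).symm
    let e' : Module.Baer.ExtensionOf i f :=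
      { e.toLinearPMap.sup l hcompat with
        le := e.le.trans le_sup_left
        is_extension := fun m => by
          rw [e.is_extension m]
          exact (LinearPMap.left_le_sup e.toLinearPMap l hcompat).2 rfl }
    have he' : e' = e := Module.Baer.extensionOfMax_is_max i f e'
      (LinearPMap.left_le_sup e.toLinearPMap l hcompat)
    rw [← he']
    exact (le_sup_right : l.domain ≤ e.domain ⊔ l.domain) (Submodule.mem_span_singleton_self y)
  refine ⟨e.toLinearPMap.toFun ∘ₗ (LinearMap.id.codRestrict e.domain fun x => by
    rw [htop]; trivial), ?_⟩
  ext n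
  exact (e.is_extension n).symm

end Baer

/-! ### Testing φ-flatness, and duals of φ-flat modules -/

section PhiFlat

variable {R : Type u} [CommRing R]

lemma isPhiTorsion_quotient {I : Ideal R} (hI : IsNonnil I) : IsPhiTorsion R (R ⧸ I) := by
  refine fun x => ⟨I, hI, fun r hr => ?_⟩
  obtain ⟨s, rfl⟩ := Submodule.Quotient.mk_surjective _ x
  rw [← Submodule.Quotient.mk_smul, Submodule.Quotient.mk_eq_zero]
  exact I.mul_mem_right s hr

variable {M : Type u} [AddCommGroup M] [Module R M]

lemma IsPhiFlat.rTensor_injective (hM : IsPhiFlat R M) {P : Type u} [AddCommGroup P] [Module R P]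
    [Module.Flat R P] (J : Submodule R P) (hJ : IsPhiTorsion R (P ⧸ J)) :
    Function.Injective (J.subtype.rTensor M) :=
  (isZero_tor_iff_rTensor_injective J.injective_subtype J.mkQ_surjective
    (LinearMap.exact_subtype_mkQ J)).1 (hM _ hJ)

lemma exists_fg_nonnil_le {I J : Ideal R} (hI : IsNonnil I) (hJ : J.FG) (hJI : J ≤ I) :
    ∃ K : Ideal R, K.FG ∧ IsNonnil K ∧ J ≤ K ∧ K ≤ I := by
  obtain ⟨s, hs, hs'⟩ := SetLike.not_le_iff_exists.1 hI
  exact ⟨J ⊔ Ideal.span {s}, Submodule.FG.sup hJ (Submodule.fg_span_singleton s),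
    fun h => hs' (h (Ideal.mem_sup_right (Ideal.mem_span_singleton_self s))), le_sup_left,
    sup_le hJI ((Ideal.span_singleton_le_iff_mem I).2 hs)⟩

/-- A tensor lives over a finitely generated subideal, which becomes nonnil after adjoining one
non-nilpotent element of `I`. -/
lemma rTensor_injective_of_forall_fg_nonnil
    (h : ∀ I : Ideal R, I.FG → IsNonnil I → Function.Injective (I.subtype.rTensor M))
    (I : Ideal R) (hI : IsNonnil I) : Function.Injective (I.subtype.rTensor M) := by
  rw [injective_iff_map_eq_zero]
  intro x hx
  obtain ⟨J, hJ, hJI, y, rfl⟩ := Submodule.exists_fg_le_eq_rTensor_inclusion x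
  obtain ⟨K, hK, hKn, hJK, hKI⟩ := exists_fg_nonnil_le hI hJ hJI
  have h1 : (J.inclusion hJI).rTensor M y =
      (K.inclusion hKI).rTensor M ((J.inclusion hJK).rTensor M y) := by
    rw [← LinearMap.rTensor_comp_apply]; rfl
  rw [h1] at hx ⊢
  rw [← LinearMap.rTensor_comp_apply] at hx
  rw [(injective_iff_map_eq_zero _).1 (h K hK hKn) _ hx, map_zero]

lemma exists_free_presentation (T : Type u) [AddCommGroup T] [Module R T] :
    ∃ (J P : Type u) (_ : AddCommGroup J) (_ : Module R J) (_ : AddCommGroup P) (_ : Module R P)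
      (f : J →ₗ[R] P) (g : P →ₗ[R] T), Module.Free R P ∧ Function.Injective f ∧
        Function.Surjective g ∧ Function.Exact f g :=
  let g : (T →₀ R) →ₗ[R] T := Finsupp.linearCombination R id
  ⟨LinearMap.ker g, T →₀ R, inferInstance, inferInstance, inferInstance, inferInstance,
    (LinearMap.ker g).subtype, g, inferInstance, (LinearMap.ker g).injective_subtype,
    fun t => ⟨Finsupp.single t 1, by simp [g]⟩, LinearMap.exact_subtype_ker_map g⟩

/-- φ-flatness can be tested on finitely generated nonnil ideals. -/
theorem isPhiFlat_iff_forall_fg_nonnil :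
    IsPhiFlat R M ↔
      ∀ I : Ideal R, I.FG → IsNonnil I → Function.Injective (I.subtype.rTensor M) := by
  refine ⟨fun hM I _ hI => hM.rTensor_injective I (isPhiTorsion_quotient hI), fun h T _ _ hT => ?_⟩
  obtain ⟨J, P, _, _, _, _, f, g, _, hf, hg, hfg⟩ := exists_free_presentation (R := R) T
  rw [isZero_tor_iff_rTensor_injective hf hg hfg, rTensor_injective_iff_lcomp_surjective]
  -- The goal is now to extend maps `J → CharacterModule M` to `P`.
  refine exists_extension_of_forall_nonnil (fun I hI => ?_) f hf fun p => ?_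
  · exact rTensor_injective_iff_lcomp_surjective.1 (rTensor_injective_of_forall_fg_nonnil h I hI)
  · obtain ⟨I, hI, hIp⟩ := hT (g p)
    exact ⟨I, hI, fun r hr => (hfg _).1 (by rw [map_smul, hIp r hr])⟩

lemma IsPhiFlat.of_linearEquiv {N : Type u} [AddCommGroup N] [Module R N] (e : M ≃ₗ[R] N)
    (hM : IsPhiFlat R M) : IsPhiFlat R N := fun T _ _ hT =>
  (hM T hT).of_iso (((Tor (ModuleCat.{u} R) 1).obj (ModuleCat.of R T)).mapIso e.symm.toModuleIso)

lemma isPhiFlat_of_projective [Module.Projective R M] : IsPhiFlat R M := fun T _ _ _ => by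
  have : Projective (ModuleCat.of R M) := (IsProjective.iff_projective M).1 inferInstance
  exact isZero_Tor_succ_of_projective _ _ _ 0

/-- The dual of a φ-flat module in an injective module is nonnil-injective. -/
theorem IsPhiFlat.isNonnilInjective_hom (hM : IsPhiFlat R M) (E : Type u) [AddCommGroup E]
    [Module R E] [Module.Injective R E] : IsNonnilInjective R (M →ₗ[R] E) := by
  intro T _ _ hT
  obtain ⟨J, P, _, _, _, _, f, g, _, hf, hg, hfg⟩ := exists_free_presentation (R := R) T
  refine subsingleton_ext_of_exists_extension hf hg hfg fun k => ?_
  obtain ⟨h, hh⟩ := Module.Injective.extension_property R E _ _ _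
    ((isZero_tor_iff_rTensor_injective hf hg hfg).1 (hM T hT)) (TensorProduct.lift k)
  refine ⟨TensorProduct.curry h, ?_⟩
  ext x m
  exact LinearMap.congr_fun hh (TensorProduct.tmul R x m)

lemma IsNonnilInjective.isNonnilFPInjective (hM : IsNonnilInjective R M) :
    IsNonnilFPInjective R M := fun T _ _ _ hT => hM T hT

end PhiFlat

/-! ### Relations among generators and coherence -/

section Coherent

variable {R : Type u} [CommRing R]

open TensorProduct

lemma exists_factor_of_ker_le {A B E : Type u} [AddCommGroup A] [Module R A] [AddCommGroup B]
    [Module R B] [AddCommGroup E] [Module R E] [Module.Injective R E]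
    (f : A →ₗ[R] B) (g : A →ₗ[R] E) (h : LinearMap.ker f ≤ LinearMap.ker g) :
    ∃ k : B →ₗ[R] E, k ∘ₗ f = g := by
  obtain ⟨k, hk⟩ := Module.Injective.extension_property R E _ _ ((LinearMap.ker f).liftQ f le_rfl)
    (LinearMap.ker_eq_bot.1 (Submodule.ker_liftQ_eq_bot _ _ _ le_rfl)) ((LinearMap.ker f).liftQ g h)
  refine ⟨k, LinearMap.ext fun x => ?_⟩
  exact LinearMap.congr_fun hk (Submodule.Quotient.mk x)

lemma exists_eq_sum_tmul {ι : Type*} [Fintype ι] {I N : Type*} [AddCommGroup I] [Module R I]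
    [AddCommGroup N] [Module R N] (a : ι → I) (ha : Submodule.span R (Set.range a) = ⊤)
    (z : I ⊗[R] N) : ∃ n : ι → N, z = ∑ i, a i ⊗ₜ[R] n i := by
  induction z with
  | zero => exact ⟨0, by simp⟩
  | tmul x n =>
    obtain ⟨c, rfl⟩ := (Submodule.mem_span_range_iff_exists_fun R).1
      (show x ∈ Submodule.span R (Set.range a) by rw [ha]; trivial)
    exact ⟨fun i => c i • n, by simp [TensorProduct.sum_tmul, TensorProduct.smul_tmul]⟩
  | add x y hx hy =>
    obtain ⟨n, rfl⟩ := hx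
    obtain ⟨m, rfl⟩ := hy
    exact ⟨n + m, by simp [TensorProduct.tmul_add, Finset.sum_add_distrib]⟩

/-- If `I` is finitely presented, every map `I → M` extends to `R`, and `E` is injective, then
`I ⊗ Hom(M, E) → Hom(M, E)` is injective. -/
lemma rTensor_hom_injective_of_finitePresentation {I : Ideal R} [Module.FinitePresentation R I]
    {M E : Type u} [AddCommGroup M] [Module R M] [AddCommGroup E] [Module R E]
    [Module.Injective R E] (hI : ∀ h : I →ₗ[R] M, ∃ h' : R →ₗ[R] M, h' ∘ₗ I.subtype = h) :
    Function.Injective (I.subtype.rTensor (M →ₗ[R] E)) := by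
  obtain ⟨n, p, hp⟩ := Module.Finite.exists_fin' R I
  obtain ⟨m, k, hk⟩ := Submodule.fg_iff_exists_fin_generating_family.1
    (Module.FinitePresentation.fg_ker p hp)
  let a : Fin n → I := fun i => p (Pi.single i 1)
  have hpa (c : Fin n → R) : p c = ∑ i, c i • a i := by
    conv_lhs => rw [pi_eq_sum_univ' c, map_sum]
    simp [a]
  have ha : Submodule.span R (Set.range a) = ⊤ := by
    rw [eq_top_iff]
    intro x _
    obtain ⟨c, rfl⟩ := hp x
    rw [hpa]
    exact Submodule.sum_mem _ fun i _ =>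
      Submodule.smul_mem _ _ (Submodule.subset_span (Set.mem_range_self i))
  rw [injective_iff_map_eq_zero]
  intro z hz
  obtain ⟨φ, rfl⟩ := exists_eq_sum_tmul a ha z
  have hφ : ∑ i, (a i : R) • φ i = 0 := by
    have := congrArg (TensorProduct.lid R _) hz
    simpa using this
  let α : (Fin n → M) →ₗ[R] (Fin m → M) :=
    LinearMap.pi fun j => ∑ i, k j i • LinearMap.proj i
  let ψ : (Fin n → M) →ₗ[R] E := ∑ i, φ i ∘ₗ LinearMap.proj i
  -- A tuple `x` in `ker α` respects all relations, so `aᵢ ↦ xᵢ` defines a map `I → M`. Extending it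
  -- to `R` gives `xᵢ = aᵢ m`, whence `ψ x = (∑ aᵢ φᵢ) m = 0`.
  obtain ⟨χ, hχ⟩ := exists_factor_of_ker_le α ψ fun x hx => by
    have hx' : ∀ j, ∑ i, k j i • x i = 0 := fun j => by
      simpa [α] using congrFun (LinearMap.mem_ker.1 hx) j
    have hker : LinearMap.ker p ≤ LinearMap.ker (Fintype.linearCombination R x) := by
      rw [← hk, Submodule.span_le]
      rintro _ ⟨j, rfl⟩
      simpa [Fintype.linearCombination_apply] using hx' j
    let h : I →ₗ[R] M := (LinearMap.ker p).liftQ _ hker ∘ₗ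
      (p.quotKerEquivOfSurjective hp).symm.toLinearMap
    have hh (c) : h (p c) = ∑ i, c i • x i := by
      have : (p.quotKerEquivOfSurjective hp).symm (p c) = Submodule.Quotient.mk c := by
        rw [LinearEquiv.symm_apply_eq]; rfl
      simp only [h, LinearMap.comp_apply, LinearEquiv.coe_coe, this]
      rfl
    obtain ⟨h', hh'⟩ := hI h
    have hxi (i) : x i = (a i : R) • h' 1 := by
      have h1 : h (a i) = x i := by
        rw [hh]; simp [Pi.single_apply]
      rw [← h1, ← hh', ← map_smul]
      simp
    rw [LinearMap.mem_ker]
    have := LinearMap.congr_fun hφ (h' 1)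
    simpa [ψ, hxi] using this
  refine TensorProduct.sum_tmul_eq_zero_of_vanishesTrivially R ⟨m, fun i j => k j i,
    fun j => χ ∘ₗ LinearMap.single R (fun _ => M) j, fun i => ?_, fun j => ?_⟩
  · ext x
    have h1 : φ i x = ψ (Pi.single i x) := by
      simp only [ψ, LinearMap.sum_apply, LinearMap.comp_apply, LinearMap.proj_apply]
      rw [Finset.sum_eq_single i (fun j _ hj => by simp [hj]) (by simp)]
      simp
    have h2 : α (Pi.single i x) = ∑ j, k j i • Pi.single j x := by
      ext j
      simp [α, Pi.single_apply, Finset.sum_apply]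
    rw [h1, ← hχ, LinearMap.comp_apply, h2]
    simp
  · rw [← hpa]
    exact LinearMap.mem_ker.1 (hk ▸ Submodule.subset_span (Set.mem_range_self j))

/-- Over a nonnil-coherent ring, duals of nonnil-FP-injective modules are φ-flat. -/
theorem IsNonnilCoherent.isPhiFlat_hom (hR : IsNonnilCoherent R) {M E : Type u} [AddCommGroup M]
    [Module R M] [AddCommGroup E] [Module R E] [Module.Injective R E]
    (hM : IsNonnilFPInjective R M) : IsPhiFlat R (M →ₗ[R] E) := by
  refine isPhiFlat_iff_forall_fg_nonnil.2 fun I hI hIn => ?_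
  have := hR I hI hIn
  have : Module.FinitePresentation R (R ⧸ I) :=
    Module.finitePresentation_of_surjective I.mkQ I.mkQ_surjective (by rwa [Submodule.ker_mkQ])
  exact rTensor_hom_injective_of_finitePresentation fun h =>
    exists_extension_of_subsingleton_ext I.injective_subtype I.mkQ_surjective
      (LinearMap.exact_subtype_mkQ I) (hM _ this (isPhiTorsion_quotient hIn)) h

/-- `E` separates the points of every module. -/
lemma IsCoseparator.exists_ne_zero {E : Type u} [AddCommGroup E] [Module R E]
    (hE : IsCoseparator (ModuleCat.of R E)) {N : Type u} [AddCommGroup N] [Module R N] {x : N}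
    (hx : x ≠ 0) : ∃ f : N →ₗ[R] E, f x ≠ 0 := by
  by_contra! H
  refine hx ?_
  have := hE.def (ModuleCat.ofHom (LinearMap.toSpanSingleton R N x)) 0 fun h => by
    ext
    simpa using H h.hom
  simpa using congrArg (fun f => f.hom (1 : R)) this

/-- Flatness of `R` gives injectivity; `Hom(Y, CharacterModule R)` is the character group of `Y`,
which separates points. -/
lemma isInjectiveCogenerator_characterModule : IsInjectiveCogenerator R (CharacterModule R) := by
  refine ⟨Module.Flat.iff_characterModule_injective.1 inferInstance,
    (isCoseparator_def _).2 fun X Y f g h => ?_⟩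
  ext x
  rw [← sub_eq_zero]
  refine CharacterModule.eq_zero_of_character_apply fun c => ?_
  let k : Y →ₗ[R] CharacterModule R := CharacterModule.curry (R := R) (A := Y) (B := R)
    (CharacterModule.dual (TensorProduct.rid R Y).toLinearMap c)
  have := congrArg (fun l => (l.hom x : CharacterModule R) (1 : R)) (h (ModuleCat.ofHom k))
  have hk (y : Y) : k y (1 : R) = c y := by
    change c (TensorProduct.rid R Y (y ⊗ₜ[R] (1 : R))) = c y
    simp
  rw [map_sub, sub_eq_zero, ← hk, ← hk]
  exact this

/-- If `E` is an injective cogenerator and `I ⊗ N → N` is injective for `N = Hom(E ^ K, E)`, with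
`K` the module of relations on generators of `I`, then `K` is finitely generated. -/
lemma relations_fg {n : ℕ} (a : Fin n → R) {E : Type u} [AddCommGroup E] [Module R E]
    (hE : IsInjectiveCogenerator R E)
    (h : Function.Injective ((Ideal.span (Set.range a)).subtype.rTensor
      (((LinearMap.ker (Fintype.linearCombination R a) : Submodule R (Fin n → R)) → E) →ₗ[R] E))) :
    (LinearMap.ker (Fintype.linearCombination R a)).FG := by
  classical
  set K : Submodule R (Fin n → R) := LinearMap.ker (Fintype.linearCombination R a) with hK
  have hKmem (c : Fin n → R) : c ∈ K ↔ ∑ i, c i * a i = 0 := by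
    simp [hK, Fintype.linearCombination_apply]
  have := hE.1
  let α : (K → E) →ₗ[R] (Fin n → K → E) := LinearMap.pi fun i => a i • LinearMap.id
  let ι : (K →₀ (Fin n → E)) →ₗ[R] (Fin n → K → E) :=
    LinearMap.pi fun i => LinearMap.pi fun k => LinearMap.proj i ∘ₗ Finsupp.lapply k
  let Φ : (K →₀ (Fin n → E)) →ₗ[R] E :=
    Finsupp.lsum R fun k : K => ∑ i, (k : Fin n → R) i • LinearMap.proj i
  obtain ⟨q, hq⟩ := exists_factor_of_ker_le ((LinearMap.range α).mkQ ∘ₗ ι) Φ fun x hx => by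
    have hx' : ι x ∈ LinearMap.range α := by simpa using hx
    obtain ⟨y, hy⟩ := hx'
    have hxy (k : K) (i : Fin n) : x k i = a i • y k := by
      simpa [α, ι] using (congrFun (congrFun hy i) k).symm
    rw [LinearMap.mem_ker]
    simp only [Φ, Finsupp.lsum_apply, Finsupp.sum]
    refine Finset.sum_eq_zero fun k _ => ?_
    simp only [LinearMap.sum_apply, LinearMap.smul_apply, LinearMap.proj_apply, hxy, smul_smul,
      ← Finset.sum_smul, (hKmem k).1 k.2, zero_smul]
  -- `Ψ` kills all `(aᵢ y)ᵢ`, so its components `rᵢ` satisfy `∑ aᵢ rᵢ = 0`; on a tuple `e` placed at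
  -- index `k` it returns `∑ kᵢ eᵢ`.
  let Ψ : (Fin n → K → E) →ₗ[R] E := q ∘ₗ (LinearMap.range α).mkQ
  have hΨι (x) : Ψ (ι x) = Φ x := LinearMap.congr_fun hq x
  have hΨα (y) : Ψ (α y) = 0 := by
    simp [Ψ, (Submodule.Quotient.mk_eq_zero (LinearMap.range α)).2 (LinearMap.mem_range_self α y)]
  let r : Fin n → ((K → E) →ₗ[R] E) := fun i => Ψ ∘ₗ LinearMap.single R (fun _ => K → E) i
  have hr (w : Fin n → K → E) : Ψ w = ∑ i, r i (w i) := by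
    conv_lhs => rw [← Finset.univ_sum_single w, map_sum]
    rfl
  have hr0 : ∑ i, a i • r i = 0 := by
    ext y
    have := hΨα y
    rw [hr] at this
    simpa [α] using this
  obtain ⟨m, b, s, hrs, hb⟩ :=
    TensorProduct.vanishesTrivially_of_sum_tmul_eq_zero_of_rTensor_injective R (m := a) (n := r) h
      ((TensorProduct.lid R _).injective (by simpa using hr0))
  refine Submodule.fg_iff_exists_fin_generating_family.2 ⟨m, fun j i => b i j, le_antisymm ?_ ?_⟩
  · rw [Submodule.span_le]
    rintro _ ⟨j, rfl⟩
    exact (hKmem _).2 (hb j)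
  · intro k hk
    by_contra hk0
    let K₀ : Submodule R (Fin n → R) := Submodule.span R (Set.range fun j i => b i j)
    have hk0' : K₀.mkQ k ≠ 0 := mt (Submodule.Quotient.mk_eq_zero K₀).1 hk0
    -- The tuple `e` read off from `χ` is killed by every column of `b` but not by `k`, yet `rᵢ = ∑
    -- bᵢⱼ sⱼ` forces `∑ kᵢ eᵢ = 0`.
    obtain ⟨χ, hχ⟩ := IsCoseparator.exists_ne_zero hE.2 hk0'
    let e : Fin n → E := fun i => χ (K₀.mkQ (Pi.single i 1))
    have he (c : Fin n → R) : χ (K₀.mkQ c) = ∑ i, c i • e i := by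
      conv_lhs => rw [pi_eq_sum_univ' c, map_sum, map_sum]
      simp [e]
    have hbe (j) : ∑ i, b i j • e i = 0 := by
      have hj : (fun i => b i j) ∈ K₀ := Submodule.subset_span (Set.mem_range_self j)
      rw [← he fun i => b i j, Submodule.mkQ_apply, (Submodule.Quotient.mk_eq_zero _).2 hj, map_zero]
    refine hχ ((he k).trans ?_)
    have h1 : Φ (Finsupp.single ⟨k, hk⟩ e) = ∑ i, k i • e i := by
      simp [Φ]
    have h2 : ι (Finsupp.single ⟨k, hk⟩ e) = fun i => Pi.single ⟨k, hk⟩ (e i) := by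
      ext i l
      by_cases hl : l = ⟨k, hk⟩
      · subst hl; simp [ι]
      · simp [ι, hl]
    rw [← h1, ← hΨι, h2, hr]
    simp only [hrs, LinearMap.sum_apply, LinearMap.smul_apply]
    rw [Finset.sum_comm]
    refine Finset.sum_eq_zero fun j _ => ?_
    have h3 : ∑ i, b i j • (Pi.single ⟨k, hk⟩ (e i) : K → E) =
        Pi.single ⟨k, hk⟩ (∑ i, b i j • e i) := by
      rw [← LinearMap.coe_single (R := R), map_sum]
      simp
    simp only [← map_smul, ← map_sum]
    rw [h3, hbe]
    simp

theorem isNonnilCoherent_of_bidual {E : Type u} [AddCommGroup E] [Module R E]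
    (hE : IsInjectiveCogenerator R E)
    (h : ∀ X : Type u, IsPhiFlat R (((X →₀ R) →ₗ[R] E) →ₗ[R] E)) : IsNonnilCoherent R := by
  intro I hI hIn
  obtain ⟨n, a, ha⟩ := Submodule.fg_iff_exists_fin_generating_family.1 hI
  have hrange : LinearMap.range (Fintype.linearCombination R a) = I := by
    rw [← ha, Fintype.range_linearCombination]
  have hfg := relations_fg a hE (by
    -- `Hom(R^(X), E) ≃ E^X`, dualised once more.
    have e (X : Type u) : (((X →₀ R) →ₗ[R] E) →ₗ[R] E) ≃ₗ[R] ((X → E) →ₗ[R] E) :=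
      LinearEquiv.congrLeft E R (Finsupp.llift E R R X).symm
    refine isPhiFlat_iff_forall_fg_nonnil.1 ((h _).of_linearEquiv (e _)) _ ?_ ?_
    · rwa [Ideal.span, ha]
    · rwa [Ideal.span, ha])
  rw [← hrange]
  exact Module.finitePresentation_of_surjective _
    (Fintype.linearCombination R a).surjective_rangeRestrict (by rwa [LinearMap.ker_rangeRestrict])

end Coherent

end PhiRing

theorem mainTheorem3 (R : Type u) [CommRing R] (hR : PhiRing.IsPhiRing R) :
    List.TFAE [
      PhiRing.IsNonnilCoherent R,
      ∀ (M E : Type u) [AddCommGroup M] [Module R M] [AddCommGroup E] [Module R E],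
        PhiRing.IsNonnilFPInjective R M → Module.Injective R E →
          PhiRing.IsPhiFlat R (M →ₗ[R] E),
      ∀ (M E : Type u) [AddCommGroup M] [Module R M] [AddCommGroup E] [Module R E],
        PhiRing.IsNonnilInjective R M → Module.Injective R E →
          PhiRing.IsPhiFlat R (M →ₗ[R] E),
      ∀ (M E₁ E₂ : Type u) [AddCommGroup M] [Module R M] [AddCommGroup E₁] [Module R E₁]
        [AddCommGroup E₂] [Module R E₂],
        PhiRing.IsPhiFlat R M → Module.Injective R E₁ → Module.Injective R E₂ →
          PhiRing.IsPhiFlat R ((M →ₗ[R] E₁) →ₗ[R] E₂),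
      ∀ (E₁ E₂ : Type u) [AddCommGroup E₁] [Module R E₁] [AddCommGroup E₂] [Module R E₂],
        PhiRing.IsInjectiveCogenerator R E₁ → PhiRing.IsInjectiveCogenerator R E₂ →
          ∀ (M : Type u) [AddCommGroup M] [Module R M], PhiRing.IsPhiFlat R M →
            PhiRing.IsPhiFlat R ((M →ₗ[R] E₁) →ₗ[R] E₂)] := by
  tfae_have 1 → 2 := fun h M E _ _ _ _ hM _ => h.isPhiFlat_hom hM
  tfae_have 2 → 3 := fun h M E _ _ _ _ hM hE => h M E hM.isNonnilFPInjective hE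
  tfae_have 3 → 4 := fun h M E₁ E₂ _ _ _ _ _ _ hM _ h₂ =>
    h (M →ₗ[R] E₁) E₂ (hM.isNonnilInjective_hom E₁) h₂
  tfae_have 4 → 5 := fun h E₁ E₂ _ _ _ _ h₁ h₂ M _ _ hM => h M E₁ E₂ hM h₁.1 h₂.1
  tfae_have 5 → 1 := fun h => PhiRing.isNonnilCoherent_of_bidual
    PhiRing.isInjectiveCogenerator_characterModule fun X =>
      h _ _ PhiRing.isInjectiveCogenerator_characterModule
        PhiRing.isInjectiveCogenerator_characterModule _ PhiRing.isPhiFlat_of_projective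
  tfae_finish
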